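/- Let $\mathfrak{sl}_2$ be the complex Lie algebra of traceless $2\times 2$ matrices with standard basis $E=\begin{pmatrix}0&1\\0&0\end{pmatrix}$, $H=\begin{pmatrix}1&0\\0&-1\end{pmatrix}$, $F=\begin{pmatrix}0&0\\1&0\end{pmatrix}$ and invariant form $(X|Y)=\operatorname{tr}(XY)$, and let $\widehat{\mathfrak{sl}}_2=\mathfrak{sl}_2\otimes\mathbb{C}[\zeta,\zeta^{-1}]\oplus\mathbb{C}K$ be the affine Lie algebra, with $X(n)=X\otimes\zeta^n$, $[X(m),Y(n)]=[X,Y](m+n)+m\,(X|Y)\,\delta_{m+n,0}K$ and $K$ central. Let $\Lambda$ be the fundamental weight of $\mathfrak{sl}_2$ and let $L(\Lambda)=\mathbb{C}v_\Lambda\oplus\mathbb{C}Fv_\Lambda$ be the fundamental representation, where $v_\Lambda\neq 0$ is a highest weight vector ($Ev_\Lambda=0$, $Hv_\Lambda=v_\Lambda$); put $v_{-\Lambda}=Fv_\Lambda$. Let $\widehat{L(\Lambda)}_1=U(\widehat{\mathfrak{sl}}_2)\otimes_{U(\mathfrak{sl}_2\otimes\mathbb{C}[\zeta]\oplus\mathbb{C}K)}L(\Lambda)$,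 where $X(0)$ acts on $L(\Lambda)$ as $X$, $X(n)$ acts as $0$ for $n>0$, and $K$ acts as $1$; let $L_{\mathfrak{sl}_2}(\Lambda,1)$ be the irreducible quotient of $\widehat{L(\Lambda)}_1$, and regard $v_{\pm\Lambda}$ as vectors of it. Let $X_1,X_2,X_3$ be an orthonormal basis of $\mathfrak{sl}_2$ with respect to $(\cdot|\cdot)$, and let $$L_n=\frac{1}{2(1+2)}\sum_{r=1}^{3}\sum_{j\in\mathbb{Z}}{:}X_r(n-j)X_r(j){:}\qquad(n\in\mathbb{Z})$$ be the Segal–Sugawara operators on $L_{\mathfrak{sl}_2}(\Lambda,1)$, where ${:}A(p)B(q){:}$ is $A(p)B(q)$ for $p<q$ and $B(q)A(p)$ for $p\ge q$ (on each vector only finitely many terms are nonzero). Let $\kappa,\tau\in\mathbb{C}$ satisfy $\kappa+2\tau-4=0$. Then in $L_{\mathfrak{sl}_2}(\Lambda,1)$ $$\Bigl(-2L_{-2}+\frac{\kappa}{2}L_{-1}^2+\frac{\tau}{2}\sum_{r=1}^{3}X_r(-1)^2\Bigr)v_{\pm\Lambda}=0 .$$ -/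

import Mathlib

namespace AffineSl2

noncomputable section

open scoped TensorProduct

/-- The complex Lie algebra `sl₂` of traceless `2 × 2` matrices. -/
abbrev sl2 : Type := LieAlgebra.SpecialLinear.sl (Fin 2) ℂ

/-- `E = (0 1; 0 0)`. -/
def E : sl2 := LieAlgebra.SpecialLinear.single 0 1 (by decide) 1

/-- `F = (0 0; 1 0)`. -/
def F : sl2 := LieAlgebra.SpecialLinear.single 1 0 (by decide) 1

/-- `H = (1 0; 0 -1)`. -/
def H : sl2 := LieAlgebra.SpecialLinear.singleSubSingle 0 1 1

/-- The invariant form `(X|Y) = tr (X Y)` on `sl₂`, the trace form of the natural representation.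
It is the one normalized by `(θ|θ) = 2` for the highest root `θ` (equivalently, `(H|H) = 2`). -/
def form : LinearMap.BilinForm ℂ sl2 := LieModule.traceForm ℂ sl2 (Fin 2 → ℂ)

theorem form_apply (X Y : sl2) : form X Y = (X.1 * Y.1).trace := by
  have h : LieModule.toEnd ℂ sl2 (Fin 2 → ℂ) X ∘ₗ LieModule.toEnd ℂ sl2 (Fin 2 → ℂ) Y
      = Matrix.toLin' (X.1 * Y.1) := by
    ext v : 1
    rw [Matrix.toLin'_mul]
    rfl
  rw [form, LieModule.traceForm_apply_apply, h, Matrix.trace_toLin'_eq]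

/-- The loop algebra `sl₂ ⊗ ℂ[ζ, ζ⁻¹]`. -/
abbrev Loop : Type := LieAlgebra.loopAlgebra ℂ ℤ sl2

/-- The 2-cocycle with `(X ⊗ ζᵐ, Y ⊗ ζⁿ) ↦ m (X|Y) δ_{m+n,0}`. It is the one that Mathlib attaches
to the form `-(·|·)`, since the cocycle of a form `Φ` there is `(f, g) ↦ Res Φ(f, dg)`, which is
`n Φ(X, Y) δ_{m+n,0}` on such a pair. -/
def cocycle : LieModule.Cohomology.twoCocycle ℂ Loop (TrivialLieModule ℂ Loop ℂ) :=
  LieAlgebra.LoopAlgebra.twoCocycleOfBilinear ℂ ℤ sl2 (-form)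
    (fun x y z => by
      simp only [LinearMap.neg_apply]
      rw [form, LieModule.traceForm_lieInvariant ℂ sl2 (Fin 2 → ℂ) x y z])
    ⟨fun x y => by
      simp only [LinearMap.neg_apply]
      rw [form, LieModule.traceForm_comm ℂ sl2 (Fin 2 → ℂ) x y]⟩

/-- The affine Lie algebra `sl₂ ⊗ ℂ[ζ, ζ⁻¹] ⊕ ℂ K`. -/
abbrev Affine : Type := LieAlgebra.ofTwoCocycle cocycle

/-- `X(n) = X ⊗ ζⁿ`. -/
def loopElt (X : sl2) (n : ℤ) : Affine :=
  LieAlgebra.ofProd cocycle (AddMonoidAlgebra.single n 1 ⊗ₜ[ℂ] X, 0)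

/-- The central element `K`. -/
def central : Affine :=
  LieAlgebra.ofProd cocycle (0, (TrivialLieModule.equiv ℂ Loop ℂ).symm 1)

theorem cocycle_apply (X Y : sl2) (m n : ℤ) :
    cocycle.1.1 (AddMonoidAlgebra.single m 1 ⊗ₜ[ℂ] X) (AddMonoidAlgebra.single n 1 ⊗ₜ[ℂ] Y)
      = (TrivialLieModule.equiv ℂ Loop ℂ).symm
        (if m + n = 0 then (m : ℂ) * form X Y else 0) := by
  change (TrivialLieModule.equiv ℂ Loop ℂ).symm (LieAlgebra.LoopAlgebra.residuePairing ℂ ℤ sl2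
    (-form) (AddMonoidAlgebra.single m 1 ⊗ₜ[ℂ] X) (AddMonoidAlgebra.single n 1 ⊗ₜ[ℂ] Y)) = _
  congr 1
  rw [LieAlgebra.LoopAlgebra.residuePairing_apply_apply,
    LieAlgebra.LoopAlgebra.toFinsupp_single_tmul, LieAlgebra.LoopAlgebra.toFinsupp_single_tmul,
    Finsupp.sum_single_index (by simp)]
  by_cases h : m + n = 0
  · obtain rfl : n = -m := by omega
    rw [neg_neg, Finsupp.single_eq_same, if_pos h]
    simp
  · rw [Finsupp.single_eq_of_ne (by omega), if_neg h]
    simp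

/-- The bracket `[X(m), Y(n)] = [X, Y](m + n) + m (X|Y) δ_{m+n,0} K`. -/
theorem loopElt_lie (X Y : sl2) (m n : ℤ) :
    ⁅loopElt X m, loopElt Y n⁆
      = loopElt ⁅X, Y⁆ (m + n) + (if m + n = 0 then (m : ℂ) * form X Y else 0) • central := by
  rw [LieAlgebra.bracket_ofTwoCocycle]
  simp only [loopElt, central, Equiv.symm_apply_apply, ← LieAlgebra.of_smul, ← LieAlgebra.of_add]
  congr 1
  refine Prod.ext ?_ ?_
  · change ⁅(AddMonoidAlgebra.single m 1 : AddMonoidAlgebra ℂ ℤ) ⊗ₜ[ℂ] X,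
      (AddMonoidAlgebra.single n 1 : AddMonoidAlgebra ℂ ℤ) ⊗ₜ[ℂ] Y⁆
        = AddMonoidAlgebra.single (m + n) 1 ⊗ₜ[ℂ] ⁅X, Y⁆ + _ • (0 : Loop)
    rw [smul_zero, add_zero, LieAlgebra.ExtendScalars.bracket_tmul,
      AddMonoidAlgebra.single_mul_single, mul_one]
  · have h := cocycle_apply X Y m n
    rw [← mul_one (if m + n = 0 then (m : ℂ) * form X Y else 0), ← smul_eq_mul, map_smul] at h
    simp only [Prod.snd_add, Prod.smul_snd, lie_zero, add_zero, sub_zero, zero_add]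
    exact h

theorem central_lie (x : Affine) : ⁅central, x⁆ = 0 := by
  rw [LieAlgebra.bracket_ofTwoCocycle]
  simp only [central, Equiv.symm_apply_apply, ← LieAlgebra.of_zero cocycle]
  congr 1
  refine Prod.ext ?_ ?_
  · simp
  · simp [trivial_lie_zero]

/-- The affine Lie algebra is spanned by the `X(n)` and `K`. -/
theorem affine_induction {p : Affine → Prop} (hadd : ∀ x y, p x → p y → p (x + y))
    (hloop : ∀ X n, p (loopElt X n)) (hcentral : ∀ c : ℂ, p (c • central)) (x : Affine) : p x := by
  have hzero : p (LieAlgebra.ofProd cocycle 0) := by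
    have := hcentral 0
    rwa [zero_smul, ← LieAlgebra.of_zero cocycle] at this
  have hfst : ∀ f : Loop, p (LieAlgebra.ofProd cocycle (f, 0)) := by
    intro f
    induction f using TensorProduct.induction_on with
    | zero => exact hzero
    | add f g hf hg =>
      have := hadd _ _ hf hg
      rwa [← LieAlgebra.of_add, Prod.mk_add_mk, add_zero] at this
    | tmul a X =>
      induction a using AddMonoidAlgebra.induction_linear with
      | zero => rw [TensorProduct.zero_tmul]; exact hzero
      | add a b ha hb =>
        have := hadd _ _ ha hb
        rwa [← LieAlgebra.of_add, Prod.mk_add_mk, add_zero, ← TensorProduct.add_tmul] at this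
      | single n c =>
        have h : (AddMonoidAlgebra.single n c : AddMonoidAlgebra ℂ ℤ) ⊗ₜ[ℂ] X
            = AddMonoidAlgebra.single n 1 ⊗ₜ[ℂ] (c • X) := by
          rw [TensorProduct.tmul_smul, TensorProduct.smul_tmul', AddMonoidAlgebra.smul_single,
            smul_eq_mul, mul_one]
        rw [h]
        exact hloop (c • X) n
  obtain ⟨⟨f, c⟩, rfl⟩ := (LieAlgebra.ofProd cocycle).surjective x
  have := hadd _ _ (hfst f) (hcentral (TrivialLieModule.equiv ℂ Loop ℂ c))
  rw [central, ← LieAlgebra.of_smul, ← LieAlgebra.of_add, Prod.smul_mk, smul_zero, Prod.mk_add_mk,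
    add_zero, zero_add, ← map_smul, smul_eq_mul, mul_one, LinearEquiv.symm_apply_apply] at this
  exact this

/-- The universal enveloping algebra of the affine Lie algebra. Representations of the affine Lie
algebra are treated as modules over it. -/
abbrev U : Type := UniversalEnvelopingAlgebra ℂ Affine

/-- `X(n)` in the universal enveloping algebra. -/
def mode (X : sl2) (n : ℤ) : U := UniversalEnvelopingAlgebra.ι ℂ (loopElt X n)

/-- `K` in the universal enveloping algebra. -/
def modeK : U := UniversalEnvelopingAlgebra.ι ℂ central

section

attribute [local instance 100] LieRing.ofAssociativeRing

theorem ι_smul_central (c : ℂ) : UniversalEnvelopingAlgebra.ι ℂ (c • central) = c • modeK :=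
  map_smul (UniversalEnvelopingAlgebra.ι ℂ) c central

theorem mode_mul_mode (X Y : sl2) (m n : ℤ) :
    mode X m * mode Y n = mode Y n * mode X m + mode ⁅X, Y⁆ (m + n)
      + (if m + n = 0 then (m : ℂ) * form X Y else 0) • modeK := by
  have h := congrArg (UniversalEnvelopingAlgebra.ι ℂ) (loopElt_lie X Y m n)
  rw [LieHom.map_lie, map_add, ι_smul_central, LieRing.of_associative_ring_bracket, sub_eq_iff_eq_add] at h
  change mode X m * mode Y n = mode ⁅X, Y⁆ (m + n) + _ + mode Y n * mode X m at h
  rw [h]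
  abel

theorem mode_mul_modeK (X : sl2) (n : ℤ) : mode X n * modeK = modeK * mode X n := by
  have h := congrArg (UniversalEnvelopingAlgebra.ι ℂ) (central_lie (loopElt X n))
  rw [LieHom.map_lie, map_zero, LieRing.of_associative_ring_bracket, sub_eq_zero] at h
  exact h.symm

end

section Induced

variable (M : Type*) [AddCommGroup M] [Module ℂ M] [LieRingModule sl2 M]

/-- The relations which turn `U ⊗_ℂ M` into `U ⊗_{U(𝔟)} M` for `𝔟 = sl₂ ⊗ ℂ[ζ] ⊕ ℂ K`, where
`X(0)` acts on `M` as `X`, `X(n)` acts as zero for `n > 0`, and `K` acts as `k`. As `𝔟` is spanned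
by the `X(n)` with `n ≥ 0` and by `K`, these generate all relations `u b ⊗ m = u ⊗ b m`. -/
def inducedRel (k : ℂ) : Submodule U (U ⊗[ℂ] M) :=
  Submodule.span U
    ({x | ∃ (X : sl2) (m : M), x = mode X 0 ⊗ₜ[ℂ] m - 1 ⊗ₜ[ℂ] ⁅X, m⁆} ∪
      {x | ∃ (X : sl2) (n : ℤ) (m : M), 0 < n ∧ x = mode X n ⊗ₜ[ℂ] m} ∪
      {x | ∃ m : M, x = modeK ⊗ₜ[ℂ] m - 1 ⊗ₜ[ℂ] (k • m)})

/-- The representation of level `k` induced from `M`. -/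
def Induced (k : ℂ) : Type _ := (U ⊗[ℂ] M) ⧸ inducedRel M k

instance (k : ℂ) : AddCommGroup (Induced M k) :=
  inferInstanceAs (AddCommGroup ((U ⊗[ℂ] M) ⧸ inducedRel M k))

instance (k : ℂ) : Module U (Induced M k) :=
  inferInstanceAs (Module U ((U ⊗[ℂ] M) ⧸ inducedRel M k))

instance (k : ℂ) : Module ℂ (Induced M k) :=
  inferInstanceAs (Module ℂ ((U ⊗[ℂ] M) ⧸ inducedRel M k))

instance (k : ℂ) : IsScalarTower ℂ U (Induced M k) :=
  inferInstanceAs (IsScalarTower ℂ U ((U ⊗[ℂ] M) ⧸ inducedRel M k))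

/-- The projection from `U ⊗_ℂ M` onto the induced representation. -/
def proj (k : ℂ) : U ⊗[ℂ] M →ₗ[U] Induced M k := (inducedRel M k).mkQ

theorem proj_eq_zero {k : ℂ} {x : U ⊗[ℂ] M} (hx : x ∈ inducedRel M k) : proj M k x = 0 :=
  (Submodule.Quotient.mk_eq_zero _).2 hx

theorem proj_surjective (k : ℂ) : Function.Surjective (proj M k) :=
  (inducedRel M k).mkQ_surjective

end Induced

/-- A representation is smooth if each of its vectors is annihilated by `X(n)` for all `X` and all
sufficiently large `n`. -/
def IsSmooth (V : Type*) [AddCommGroup V] [Module U V] : Prop :=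
  ∀ w : V, ∃ N : ℤ, ∀ n ≥ N, ∀ X : sl2, mode X n • w = 0

/-- The normally ordered product of `X(p)` and `Y(q)`. -/
def normalOrdered (X Y : sl2) (p q : ℤ) : U :=
  if p < q then mode X p * mode Y q else mode Y q * mode X p

theorem IsSmooth.finite_support {V : Type*} [AddCommGroup V] [Module U V] (hV : IsSmooth V)
    (X Y : sl2) (n : ℤ) (w : V) :
    (Function.support fun j : ℤ => normalOrdered X Y (n - j) j • w).Finite := by
  obtain ⟨N, hN⟩ := hV w
  refine (Set.finite_Icc (-(|n| + |N|)) (|n| + |N|)).subset fun j hj => ?_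
  rw [Function.mem_support, normalOrdered] at hj
  have h1 := neg_abs_le n
  have h2 := neg_abs_le N
  have h3 := le_abs_self n
  have h4 := le_abs_self N
  split_ifs at hj with h
  · have : j < N := by
      by_contra hc
      exact hj (by rw [mul_smul, hN j (by omega), smul_zero])
    constructor <;> omega
  · have : n - j < N := by
      by_contra hc
      exact hj (by rw [mul_smul, hN (n - j) (by omega), smul_zero])
    constructor <;> omega

section Sugawara

variable {V : Type*} [AddCommGroup V] [Module ℂ V] [Module U V] [IsScalarTower ℂ U V]

/-- The operator by which an element of the enveloping algebra acts on a representation. -/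
abbrev act (V : Type*) [AddCommGroup V] [Module ℂ V] [Module U V] [IsScalarTower ℂ U V]
    (u : U) : Module.End ℂ V := Algebra.lsmul ℂ ℂ V u

/-- The operator `∑_{j ∈ ℤ} :X(n - j) Y(j):` on a smooth representation; only finitely many terms
are nonzero on each vector. -/
def normalOrderedSum (hV : IsSmooth V) (X Y : sl2) (n : ℤ) : Module.End ℂ V where
  toFun w := ∑ᶠ j : ℤ, normalOrdered X Y (n - j) j • w
  map_add' w w' := by
    simp only [smul_add]
    exact finsum_add_distrib (hV.finite_support X Y n w) (hV.finite_support X Y n w')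
  map_smul' c w := by
    rw [RingHom.id_apply, smul_finsum]
    exact finsum_congr fun j => ((Algebra.lsmul ℂ ℂ V _).map_smul c w)

/-- The vectors that are annihilated by `X(n)` for all `X` and all sufficiently large `n`. -/
def smoothPart (V : Type*) [AddCommGroup V] [Module ℂ V] [Module U V] [IsScalarTower ℂ U V] :
    Submodule ℂ V where
  carrier := {w | ∃ b : ℤ, ∀ n ≥ b, ∀ X : sl2, mode X n • w = 0}
  zero_mem' := ⟨0, fun n _ X => smul_zero _⟩
  add_mem' := by
    rintro w w' ⟨b, hb⟩ ⟨b', hb'⟩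
    refine ⟨max b b', fun n hn X => ?_⟩
    rw [smul_add, hb n (by omega), hb' n (by omega), add_zero]
  smul_mem' := by
    rintro c w ⟨b, hb⟩
    refine ⟨b, fun n hn X => ?_⟩
    have h : mode X n • c • w = c • mode X n • w := (Algebra.lsmul ℂ ℂ _ (mode X n)).map_smul c w
    rw [h, hb n hn, smul_zero]

theorem ι_smul_mem_smoothPart (x : Affine) :
    ∀ w ∈ smoothPart V, UniversalEnvelopingAlgebra.ι ℂ x • w ∈ smoothPart V := by
  induction x using affine_induction with
  | hadd x y hx hy =>
    intro w hw
    rw [map_add, add_smul]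
    exact add_mem (hx w hw) (hy w hw)
  | hloop Y m =>
    rintro w ⟨b, hb⟩
    refine ⟨max (max b (b - m)) (1 - m), fun n hn X => ?_⟩
    change mode X n • mode Y m • w = 0
    rw [← mul_smul, mode_mul_mode, if_neg (by omega), zero_smul, add_zero, add_smul, mul_smul,
      hb n (by omega), hb (n + m) (by omega), smul_zero, add_zero]
  | hcentral c =>
    rintro w ⟨b, hb⟩
    rw [ι_smul_central, smul_assoc]
    refine Submodule.smul_mem _ c ⟨b, fun n hn X => ?_⟩
    rw [← mul_smul, mode_mul_modeK, mul_smul, hb n hn, smul_zero]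

theorem smul_mem_smoothPart (u : U) : ∀ w ∈ smoothPart V, u • w ∈ smoothPart V := by
  obtain ⟨t, rfl⟩ : ∃ t, UniversalEnvelopingAlgebra.mkAlgHom ℂ Affine t = u :=
    RingCon.mkₐ_surjective _ u
  induction t using TensorAlgebra.induction with
  | algebraMap c =>
    intro w hw
    rw [AlgHom.commutes, algebraMap_smul]
    exact Submodule.smul_mem _ c hw
  | ι x => exact ι_smul_mem_smoothPart x
  | mul a b ha hb =>
    intro w hw
    rw [map_mul, mul_smul]
    exact ha _ (hb w hw)
  | add a b ha hb =>
    intro w hw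
    rw [map_add, add_smul]
    exact add_mem (ha w hw) (hb w hw)

/-- The dual Coxeter number of `sl₂`. -/
def dualCoxeter : ℂ := 2

/-- The Segal–Sugawara operator `L_n = (2 (k + h^∨))⁻¹ ∑_a ∑_j :X_a(n - j) X_a(j):` on a smooth
representation of level `k`, for an orthonormal basis `X_a` of `sl₂`. -/
def sugawara (hV : IsSmooth V) (k : ℂ) (X : Fin 3 → sl2) (n : ℤ) : Module.End ℂ V :=
  (1 / (2 * (k + dualCoxeter))) • ∑ a, normalOrderedSum hV (X a) (X a) n

end Sugawara

section Quotient

variable {M : Type*} [AddCommGroup M] [Module ℂ M] [LieRingModule sl2 M]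
  {k : ℂ}

/-- The vector `m` of `M`, as a vector in the top space of a quotient of the induced
representation. -/
def top (N : Submodule U (Induced M k)) (m : M) : Induced M k ⧸ N :=
  N.mkQ (proj M k (1 ⊗ₜ[ℂ] m))

theorem isSmooth_quotient (N : Submodule U (Induced M k)) : IsSmooth (Induced M k ⧸ N) := by
  have htop : ∀ m : M, top N m ∈ smoothPart (Induced M k ⧸ N) := by
    refine fun m => ⟨1, fun n hn X => ?_⟩
    have h : mode X n • (1 : U) ⊗ₜ[ℂ] m ∈ inducedRel M k := by
      rw [TensorProduct.smul_tmul', smul_eq_mul, mul_one]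
      exact Submodule.subset_span (Or.inl (Or.inr ⟨X, n, m, by omega, rfl⟩))
    rw [top, ← map_smul, ← map_smul, proj_eq_zero M h, map_zero]
  intro w
  obtain ⟨w, rfl⟩ := N.mkQ_surjective w
  obtain ⟨w, rfl⟩ := proj_surjective M k w
  change N.mkQ (proj M k w) ∈ smoothPart (Induced M k ⧸ N)
  induction w using TensorProduct.induction_on with
  | zero => rw [map_zero, map_zero]; exact zero_mem _
  | add x y hx hy => rw [map_add, map_add]; exact add_mem hx hy
  | tmul u m =>
    have h : (u ⊗ₜ[ℂ] m : U ⊗[ℂ] M) = u • ((1 : U) ⊗ₜ[ℂ] m) := by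
      rw [TensorProduct.smul_tmul', smul_eq_mul, mul_one]
    rw [h, map_smul, map_smul]
    exact smul_mem_smoothPart u _ (htop m)

/-- The operator `L_n` on a quotient of the induced representation of level `k`. -/
def virasoro (N : Submodule U (Induced M k)) (X : Fin 3 → sl2) (n : ℤ) :
    Module.End ℂ (Induced M k ⧸ N) :=
  sugawara (isSmooth_quotient N) k X n

end Quotient

end

end AffineSl2

namespace AffineSl2

noncomputable section

open scoped TensorProduct

/-! Write `v` and `v' = F v` for the two top vectors. Everything rests on the relation `E(-1) v = 0`
in the irreducible quotient. In the induced module `E(-1) v` is singular: the only doubtful mode is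
`F(1)`, and `F(1) E(-1) v = (K - H(0)) v = 0` because both the level and the weight are `1`.

To see that this singular vector dies (`eq_zero_of_singular`), the quotient is graded by `D = Ω(0,
0) + 2 ∑_{j > 0} Ω(-j, j)`, which is `6 L_0` at level one. A mode `X(m)` with `m ≤ 0` raises
eigenvalues of `D` by `-6m` (`shifts_neg`). If `E(-1) v` were nonzero, simplicity would make every
vector a descendant of it under nonpositive modes. Then `v`, of eigenvalue `3/2`, would lie in the
sum of the eigenspaces for `3/2 + 6 + 6n`, against the independence of eigenspaces.

Applying `F(0)` and modes of index `-1` to `E(-1) v = 0` expresses all vectors that occur through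
`H(-1)` and `H(-2)`. With `A = (1/2) H(-1)² v + H(-2) v` one finds `L_{-2} v = A / 2`, `L_{-1}² v =
A / 2` and `∑ X_r(-1)² v = A`. The claimed expression is therefore `(-1 + κ/4 + τ/2) A`, which
vanishes since `κ + 2τ = 4`. For `v'` the sign of `H(-2)` changes and the rest is identical. -/

/-! ### Brackets, trace form and Casimir element of `sl₂`. -/

theorem lie_E_F : ⁅E, F⁆ = H := by
  apply Subtype.ext
  rw [LieAlgebra.SpecialLinear.sl_bracket]
  ext i j
  fin_cases i <;> fin_cases j <;>
    simp [E, F, H]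

theorem lie_H_E : ⁅H, E⁆ = (2 : ℂ) • E := by
  apply Subtype.ext
  rw [LieAlgebra.SpecialLinear.sl_bracket]
  ext i j
  fin_cases i <;> fin_cases j <;>
    simp [E, H, Matrix.mul_apply, Matrix.single_apply]
  norm_num

theorem lie_H_F : ⁅H, F⁆ = (-2 : ℂ) • F := by
  apply Subtype.ext
  rw [LieAlgebra.SpecialLinear.sl_bracket]
  ext i j
  fin_cases i <;> fin_cases j <;>
    simp [F, H, Matrix.mul_apply, Matrix.single_apply]
  norm_num

theorem lie_F_E : ⁅F, E⁆ = (-1 : ℂ) • H := by rw [← lie_skew, lie_E_F, neg_one_smul]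

theorem form_comm (X Y : sl2) : form X Y = form Y X := by
  rw [form_apply, form_apply, Matrix.trace_mul_comm]

theorem sl2_apply_one_one (X : sl2) : X.1 1 1 = -X.1 0 0 := by
  have h : X.1.trace = 0 := X.2
  rw [Matrix.trace_fin_two] at h
  linear_combination h

theorem form_eq (X Y : sl2) :
    form X Y = 2 * (X.1 0 0 * Y.1 0 0) + X.1 0 1 * Y.1 1 0 + X.1 1 0 * Y.1 0 1 := by
  rw [form_apply, Matrix.trace_fin_two, Matrix.mul_apply, Matrix.mul_apply, Fin.sum_univ_two,
    Fin.sum_univ_two, sl2_apply_one_one X, sl2_apply_one_one Y]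
  ring

theorem form_E (X : sl2) : form X E = X.1 1 0 := by
  rw [form_eq]; simp [E]

theorem form_F (X : sl2) : form X F = X.1 0 1 := by
  rw [form_eq]; simp [F]

theorem form_H (X : sl2) : form X H = 2 * X.1 0 0 := by
  rw [form_eq]; simp [H]

theorem form_E_E : form E E = 0 := by rw [form_E]; simp [E]

theorem form_F_E : form F E = 1 := by rw [form_E]; simp [F]

theorem form_H_E : form H E = 0 := by rw [form_E]; simp [H]

theorem form_E_F : form E F = 1 := by rw [form_comm, form_F_E]

theorem form_F_F : form F F = 0 := by rw [form_F]; simp [F]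

theorem form_H_F : form H F = 0 := by rw [form_F]; simp [H]

theorem form_H_H : form H H = 2 := by rw [form_H]; simp [H]

theorem eq_smul_add (X : sl2) : X = X.1 0 1 • E + X.1 1 0 • F + X.1 0 0 • H := by
  have := sl2_apply_one_one X
  apply Subtype.ext
  ext i j
  fin_cases i <;> fin_cases j <;> simp [E, F, H, this]

/-- Completeness relation for the dual bases `E, F, H` and `F, E, H/2`. It is what makes the Casimir
element independent of the basis. -/
theorem form_eq_casimir (X Y : sl2) :
    form X Y = form X E * form Y F + form X F * form Y E + 1 / 2 * (form X H * form Y H) := by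
  rw [form_eq, form_E, form_E, form_F, form_F, form_H, form_H]
  ring

/-- Contraction of a bilinear map with the Casimir element, in an orthonormal basis and in the
basis `E, F, H`. -/
theorem sum_orthonormal {W : Type*} [AddCommGroup W] [Module ℂ W]
    (X : Module.Basis (Fin 3) ℂ sl2) (hX : ∀ r s, form (X r) (X s) = if r = s then 1 else 0)
    (B : sl2 →ₗ[ℂ] sl2 →ₗ[ℂ] W) :
    ∑ r, B (X r) (X r) = B E F + B F E + (1 / 2 : ℂ) • B H H := by
  -- Orthonormality identifies the coordinates in the basis `X` with pairings against its elements.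
  have hexp (Y : sl2) : Y = ∑ r, form (X r) Y • X r := by
    conv_lhs => rw [← X.sum_repr Y]
    refine Finset.sum_congr rfl fun r _ => ?_
    congr 1
    conv_rhs => rw [← X.sum_repr Y, map_sum]
    simp only [map_smul, smul_eq_mul, hX, mul_ite, mul_one, mul_zero]
    simp
  have hB (Y Z : sl2) : B Y Z = ∑ r, ∑ s, (form (X r) Y * form (X s) Z) • B (X r) (X s) := by
    conv_lhs => rw [hexp Y, hexp Z]
    simp only [map_sum, LinearMap.sum_apply, map_smul, LinearMap.smul_apply, Finset.smul_sum,
      smul_smul]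
    rw [Finset.sum_comm]
    refine Finset.sum_congr rfl fun r _ => Finset.sum_congr rfl fun s _ => ?_
    rw [mul_comm]
  rw [hB E F, hB F E, hB H H]
  simp only [Finset.smul_sum, smul_smul, ← Finset.sum_add_distrib, ← add_smul,
    ← form_eq_casimir, hX]
  simp

/-! ### Modes in the enveloping algebra and the action of `K`. -/

section

attribute [local instance 100] LieRing.ofAssociativeRing

/-- `X(n)` as a linear function of `X`. -/
def modeₗ (n : ℤ) : sl2 →ₗ[ℂ] U :=
  (UniversalEnvelopingAlgebra.ι ℂ : Affine →ₗ⁅ℂ⁆ U).toLinearMap.comp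
    { toFun := fun X => loopElt X n
      map_add' := fun X Y => by
        rw [loopElt, loopElt, loopElt, ← LieAlgebra.of_add, TensorProduct.tmul_add, Prod.mk_add_mk,
          add_zero]
      map_smul' := fun c X => by
        rw [loopElt, loopElt, RingHom.id_apply, ← LieAlgebra.of_smul, TensorProduct.tmul_smul,
          Prod.smul_mk, smul_zero] }

end

theorem mode_smul (c : ℂ) (X : sl2) (n : ℤ) : mode (c • X) n = c • mode X n :=
  map_smul (modeₗ n) c X

theorem mode_add (X Y : sl2) (n : ℤ) : mode (X + Y) n = mode X n + mode Y n :=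
  map_add (modeₗ n) X Y

theorem mode_zero (n : ℤ) : mode 0 n = 0 := map_zero (modeₗ n)

/-- The enveloping algebra is generated by the modes and `K`. -/
theorem smul_mem_of_mode {V : Type*} [AddCommGroup V] [Module ℂ V] [Module U V]
    [IsScalarTower ℂ U V] (W : Submodule ℂ V) (hmode : ∀ X n, ∀ w ∈ W, mode X n • w ∈ W)
    (hK : ∀ w ∈ W, modeK • w ∈ W) (u : U) : ∀ w ∈ W, u • w ∈ W := by
  obtain ⟨t, rfl⟩ : ∃ t, UniversalEnvelopingAlgebra.mkAlgHom ℂ Affine t = u :=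
    RingCon.mkₐ_surjective _ u
  induction t using TensorAlgebra.induction with
  | algebraMap c =>
    intro w hw
    rw [AlgHom.commutes, algebraMap_smul]
    exact W.smul_mem c hw
  | ι x =>
    change ∀ w ∈ W, UniversalEnvelopingAlgebra.ι ℂ x • w ∈ W
    induction x using affine_induction with
    | hadd x y hx hy =>
      intro w hw
      rw [map_add, add_smul]
      exact add_mem (hx w hw) (hy w hw)
    | hloop X n => exact hmode X n
    | hcentral c =>
      intro w hw
      rw [ι_smul_central, smul_assoc]
      exact W.smul_mem c (hK w hw)
  | mul a b ha hb =>
    intro w hw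
    rw [map_mul, mul_smul]
    exact ha _ (hb w hw)
  | add a b ha hb =>
    intro w hw
    rw [map_add, add_smul]
    exact add_mem (ha w hw) (hb w hw)

/-- The enveloping algebra preserves the vectors on which `K` acts as `k`. -/
theorem modeK_smul_comm {V : Type*} [AddCommGroup V] [Module ℂ V] [Module U V]
    [IsScalarTower ℂ U V] {k : ℂ} (u : U) : ∀ w : V, modeK • w = k • w →
      modeK • u • w = k • u • w := by
  let W : Submodule ℂ V :=
    { carrier := {w | modeK • w = k • w}
      zero_mem' := by simp
      add_mem' := fun {a b} ha hb => by
        change _ = _ at ha hb ⊢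
        rw [smul_add, smul_add, ha, hb]
      smul_mem' := fun c w hw => by
        change _ = _ at hw ⊢
        rw [smul_comm modeK c, hw, smul_comm] }
  refine smul_mem_of_mode W (fun X n w hw => ?_) (fun w hw => ?_) u
  · change modeK • w = k • w at hw
    change modeK • mode X n • w = k • mode X n • w
    rw [← mul_smul, ← mode_mul_modeK, mul_smul, hw, smul_comm]
  · change modeK • w = k • w at hw
    change modeK • modeK • w = k • modeK • w
    rw [hw, smul_comm, hw]

/-- `K` acts as `k` on quotients of the induced representation of level `k`. -/
theorem modeK_smul_quotient {M : Type*} [AddCommGroup M] [Module ℂ M] [LieRingModule sl2 M]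
    {k : ℂ} (N : Submodule U (Induced M k)) (w : Induced M k ⧸ N) : modeK • w = k • w := by
  obtain ⟨w, rfl⟩ := N.mkQ_surjective w
  obtain ⟨w, rfl⟩ := proj_surjective M k w
  induction w using TensorProduct.induction_on with
  | zero => simp
  | add x y hx hy => rw [map_add, map_add, smul_add, smul_add, hx, hy]
  | tmul u m =>
    have h : (u ⊗ₜ[ℂ] m : U ⊗[ℂ] M) = u • ((1 : U) ⊗ₜ[ℂ] m) := by
      rw [TensorProduct.smul_tmul', smul_eq_mul, mul_one]
    rw [h, map_smul, map_smul]
    refine modeK_smul_comm u _ ?_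
    have h1 : modeK • ((1 : U) ⊗ₜ[ℂ] m) - k • ((1 : U) ⊗ₜ[ℂ] m) ∈ inducedRel M k := by
      rw [TensorProduct.smul_tmul', smul_eq_mul, mul_one, ← TensorProduct.tmul_smul]
      exact Submodule.subset_span (Or.inr ⟨m, rfl⟩)
    have h2 := proj_eq_zero M h1
    rw [map_sub, sub_eq_zero] at h2
    rw [← map_smul, ← map_smul, h2]
    rfl

/-! ### The top space of a quotient of the induced module. -/

section Top

variable {M : Type*} [AddCommGroup M] [Module ℂ M] [LieRingModule sl2 M]
  {k : ℂ} (N : Submodule U (Induced M k))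

theorem mode_zero_smul_top (X : sl2) (m : M) : mode X 0 • top N m = top N ⁅X, m⁆ := by
  have h1 : mode X 0 • ((1 : U) ⊗ₜ[ℂ] m) - (1 : U) ⊗ₜ[ℂ] ⁅X, m⁆ ∈ inducedRel M k := by
    rw [TensorProduct.smul_tmul', smul_eq_mul, mul_one]
    exact Submodule.subset_span (Or.inl (Or.inl ⟨X, m, rfl⟩))
  have h2 := proj_eq_zero M h1
  rw [map_sub, sub_eq_zero, map_smul] at h2
  rw [top, ← map_smul, h2, top]

theorem mode_pos_smul_top (X : sl2) (m : M) {n : ℤ} (hn : 0 < n) : mode X n • top N m = 0 := by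
  have h : mode X n • (1 : U) ⊗ₜ[ℂ] m ∈ inducedRel M k := by
    rw [TensorProduct.smul_tmul', smul_eq_mul, mul_one]
    exact Submodule.subset_span (Or.inl (Or.inr ⟨X, n, m, hn, rfl⟩))
  rw [top, ← map_smul, ← map_smul, proj_eq_zero M h, map_zero]

/-- `top` as a linear map. -/
def topₗ : M →ₗ[ℂ] Induced M k ⧸ N where
  toFun := top N
  map_add' x y := by rw [top, TensorProduct.tmul_add, map_add, map_add]; rfl
  map_smul' c x := by rw [top, TensorProduct.tmul_smul]; rfl

/-- The kernel of `topₗ N` is an `sl₂`-submodule of the irreducible `M`. If it were everything, the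
quotient, being generated by its top space, would be zero. -/
theorem top_ne_zero [LieModule ℂ sl2 M] [LieModule.IsIrreducible ℂ sl2 M]
    [Nontrivial (Induced M k ⧸ N)] {m : M} (hm : m ≠ 0) : top N m ≠ 0 := by
  intro h0
  let P : LieSubmodule ℂ sl2 M :=
    { LinearMap.ker (topₗ N) with
      lie_mem := fun {X x} hx => by
        change top N x = 0 at hx
        change top N ⁅X, x⁆ = 0
        rw [← mode_zero_smul_top, hx, smul_zero] }
  have hP : P = ⊤ := by
    refine (IsSimpleOrder.eq_bot_or_eq_top P).resolve_left fun h => hm ?_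
    have : m ∈ P := h0
    rwa [h, LieSubmodule.mem_bot] at this
  obtain ⟨w, hw⟩ := exists_ne (0 : Induced M k ⧸ N)
  refine hw ?_
  obtain ⟨w, rfl⟩ := N.mkQ_surjective w
  obtain ⟨w, rfl⟩ := proj_surjective M k w
  clear hw
  induction w using TensorProduct.induction_on with
  | zero => rw [map_zero, map_zero]
  | add x y hx hy => rw [map_add, map_add, hx, hy, add_zero]
  | tmul u m =>
    have h : (u ⊗ₜ[ℂ] m : U ⊗[ℂ] M) = u • ((1 : U) ⊗ₜ[ℂ] m) := by
      rw [TensorProduct.smul_tmul', smul_eq_mul, mul_one]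
    have hm : m ∈ P := hP ▸ LieSubmodule.mem_top m
    rw [h, map_smul, map_smul]
    exact (congrArg (u • ·) (show top N m = 0 from hm)).trans (smul_zero u)

end Top

/-- In the fundamental representation, `F` kills the lower basis vector. -/
theorem lie_F_lie_F {M : Type*} [AddCommGroup M] [Module ℂ M] [LieRingModule sl2 M]
    [LieModule ℂ sl2 M] [FiniteDimensional ℂ M] {v : M} (hE : ⁅E, v⁆ = 0) (hH : ⁅H, v⁆ = v) :
    ⁅F, ⁅F, v⁆⁆ = 0 := by
  have hHF : ⁅H, ⁅F, v⁆⁆ = -⁅F, v⁆ := by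
    rw [leibniz_lie, lie_H_F, hH, smul_lie]; module
  have hEF : ⁅E, ⁅F, v⁆⁆ = v := by
    rw [leibniz_lie, lie_E_F, hE, hH, lie_zero, add_zero]
  by_contra h
  have ht : IsSl2Triple H E F :=
    { h_ne_zero := fun h0 => by have := form_H_H; rw [h0] at this; simp at this
      lie_e_f := lie_E_F
      lie_h_e_nsmul := by rw [lie_H_E, two_smul, two_smul]
      lie_h_f_nsmul := by rw [lie_H_F, neg_smul, two_smul, two_smul] }
  -- A nonzero `F² v` would be a highest weight vector of weight `1 - 4 = -3`, while finite
  -- dimension forces such weights to be natural numbers.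
  have hp : ht.HasPrimitiveVectorWith ⁅F, ⁅F, v⁆⁆ (-3 : ℂ) :=
    { ne_zero := h
      lie_h := by rw [leibniz_lie, lie_H_F, hHF, smul_lie, lie_neg]; module
      lie_e := by rw [leibniz_lie, lie_E_F, hEF, hHF, neg_add_cancel] }
  obtain ⟨n, hn⟩ := hp.exists_nat
  have h3 : ((n + 3 : ℕ) : ℂ) = 0 := by push_cast; linear_combination -hn
  rw [Nat.cast_eq_zero] at h3
  omega

/-! ### Level-one commutation relations and the degree operator. -/

section LevelOne

variable {V : Type*} [AddCommGroup V] [Module ℂ V] [Module U V] [IsScalarTower ℂ U V]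

/-- The action of `X(n)` on a representation. -/
def modeOp (X : sl2) (n : ℤ) : Module.End ℂ V := act V (mode X n)

theorem modeOp_apply (X : sl2) (n : ℤ) (w : V) : modeOp X n w = mode X n • w := rfl

theorem modeOp_smul (c : ℂ) (X : sl2) (n : ℤ) (w : V) :
    modeOp (c • X) n w = c • modeOp X n w := by
  rw [modeOp_apply, mode_smul, smul_assoc, modeOp_apply]

theorem modeOp_add (X Y : sl2) (n : ℤ) (w : V) :
    modeOp (X + Y) n w = modeOp X n w + modeOp Y n w := by
  rw [modeOp_apply, mode_add, add_smul, modeOp_apply, modeOp_apply]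

theorem modeOp_zero (n : ℤ) (w : V) : modeOp 0 n w = 0 := by
  rw [modeOp_apply, mode_zero, zero_smul]

theorem modeOp_eq (X : sl2) (n : ℤ) (w : V) :
    modeOp X n w = X.1 0 1 • modeOp E n w + X.1 1 0 • modeOp F n w + X.1 0 0 • modeOp H n w := by
  conv_lhs => rw [eq_smul_add X]
  rw [modeOp_add, modeOp_add, modeOp_smul, modeOp_smul, modeOp_smul]

theorem modeOp_eq_zero {n : ℤ} {w : V} (hE : modeOp E n w = 0) (hF : modeOp F n w = 0)
    (hH : modeOp H n w = 0) (X : sl2) : modeOp X n w = 0 := by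
  rw [modeOp_eq, hE, hF, hH, smul_zero, smul_zero, smul_zero, add_zero, add_zero]

theorem modeOp_comm (hK : ∀ w : V, modeK • w = w) (X Y : sl2) (m n : ℤ) (w : V) :
    modeOp X m (modeOp Y n w) = modeOp Y n (modeOp X m w) + modeOp ⁅X, Y⁆ (m + n) w
      + (if m + n = 0 then (m : ℂ) * form X Y else 0) • w := by
  simp only [modeOp_apply]
  rw [← mul_smul, mode_mul_mode, add_smul, add_smul, mul_smul, smul_assoc, hK]

theorem modeOp_E_E (hK : ∀ w : V, modeK • w = w) (m n : ℤ) (w : V) :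
    modeOp E m (modeOp E n w) = modeOp E n (modeOp E m w) := by
  rw [modeOp_comm hK, lie_self, form_E_E, mul_zero, ite_self, zero_smul, modeOp_zero, add_zero,
    add_zero]

theorem modeOp_F_F (hK : ∀ w : V, modeK • w = w) (m n : ℤ) (w : V) :
    modeOp F m (modeOp F n w) = modeOp F n (modeOp F m w) := by
  rw [modeOp_comm hK, lie_self, form_F_F, mul_zero, ite_self, zero_smul, modeOp_zero, add_zero,
    add_zero]

theorem modeOp_H_H (hK : ∀ w : V, modeK • w = w) (m n : ℤ) (w : V) :
    modeOp H m (modeOp H n w) = modeOp H n (modeOp H m w)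
      + (if m + n = 0 then 2 * (m : ℂ) else 0) • w := by
  rw [modeOp_comm hK, lie_self, form_H_H, modeOp_zero, add_zero, mul_comm]

theorem modeOp_E_F (hK : ∀ w : V, modeK • w = w) (m n : ℤ) (w : V) :
    modeOp E m (modeOp F n w) = modeOp F n (modeOp E m w) + modeOp H (m + n) w
      + (if m + n = 0 then (m : ℂ) else 0) • w := by
  rw [modeOp_comm hK, lie_E_F, form_E_F, mul_one]

theorem modeOp_F_E (hK : ∀ w : V, modeK • w = w) (m n : ℤ) (w : V) :
    modeOp F m (modeOp E n w) = modeOp E n (modeOp F m w) - modeOp H (m + n) w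
      + (if m + n = 0 then (m : ℂ) else 0) • w := by
  rw [modeOp_comm hK, lie_F_E, form_F_E, mul_one, modeOp_smul, neg_one_smul, sub_eq_add_neg]

theorem modeOp_H_E (hK : ∀ w : V, modeK • w = w) (m n : ℤ) (w : V) :
    modeOp H m (modeOp E n w) = modeOp E n (modeOp H m w) + (2 : ℂ) • modeOp E (m + n) w := by
  rw [modeOp_comm hK, lie_H_E, form_H_E, mul_zero, ite_self, zero_smul, add_zero, modeOp_smul]

theorem modeOp_H_F (hK : ∀ w : V, modeK • w = w) (m n : ℤ) (w : V) :
    modeOp H m (modeOp F n w) = modeOp F n (modeOp H m w) - (2 : ℂ) • modeOp F (m + n) w := by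
  rw [modeOp_comm hK, lie_H_F, form_H_F, mul_zero, ite_self, zero_smul, add_zero, modeOp_smul,
    neg_smul, sub_eq_add_neg]

theorem modeOp_E_H (hK : ∀ w : V, modeK • w = w) (m n : ℤ) (w : V) :
    modeOp E m (modeOp H n w) = modeOp H n (modeOp E m w) - (2 : ℂ) • modeOp E (m + n) w := by
  rw [modeOp_H_E hK, add_comm n m, add_sub_cancel_right]

theorem modeOp_F_H (hK : ∀ w : V, modeK • w = w) (m n : ℤ) (w : V) :
    modeOp F m (modeOp H n w) = modeOp H n (modeOp F m w) + (2 : ℂ) • modeOp F (m + n) w := by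
  rw [modeOp_H_F hK, add_comm n m, sub_add_cancel]

/-- The mode `Ω(p, q) = E(p) F(q) + F(p) E(q) + H(p) H(q) / 2` of the Casimir element. -/
def casimirOp (p q : ℤ) : Module.End ℂ V :=
  modeOp E p * modeOp F q + modeOp F p * modeOp E q + (1 / 2 : ℂ) • (modeOp H p * modeOp H q)

theorem casimirOp_apply (p q : ℤ) (w : V) :
    casimirOp p q w = modeOp E p (modeOp F q w) + modeOp F p (modeOp E q w)
      + (1 / 2 : ℂ) • modeOp H p (modeOp H q w) := rfl

theorem casimirOp_E (hK : ∀ w : V, modeK • w = w) (p q m : ℤ) (w : V) :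
    casimirOp p q (modeOp E m w) = modeOp E m (casimirOp p q w)
      + (modeOp H p (modeOp E (q + m) w) - modeOp E p (modeOp H (q + m) w))
      - (modeOp H (p + m) (modeOp E q w) - modeOp E (p + m) (modeOp H q w))
      + (if q + m = 0 then (q : ℂ) else 0) • modeOp E p w
      + (if p + m = 0 then (p : ℂ) else 0) • modeOp E q w := by
  simp only [casimirOp_apply, modeOp_F_E hK _ m, modeOp_E_E hK _ m, modeOp_H_E hK _ m, map_add,
    map_sub, map_smul]
  module

theorem casimirOp_F (hK : ∀ w : V, modeK • w = w) (p q m : ℤ) (w : V) :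
    casimirOp p q (modeOp F m w) = modeOp F m (casimirOp p q w)
      + (modeOp F p (modeOp H (q + m) w) - modeOp H p (modeOp F (q + m) w))
      - (modeOp F (p + m) (modeOp H q w) - modeOp H (p + m) (modeOp F q w))
      + (if q + m = 0 then (q : ℂ) else 0) • modeOp F p w
      + (if p + m = 0 then (p : ℂ) else 0) • modeOp F q w := by
  simp only [casimirOp_apply, modeOp_E_F hK _ m, modeOp_F_F hK _ m, modeOp_H_F hK _ m, map_add,
    map_sub, map_smul]
  module

theorem ite_eq_zero_cast (q : ℤ) : (if q = 0 then (q : ℂ) else 0) = 0 := by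
  split_ifs with h
  · rw [h, Int.cast_zero]
  · rfl

theorem casimirOp_E_zero (hK : ∀ w : V, modeK • w = w) (p q : ℤ) (w : V) :
    casimirOp p q (modeOp E 0 w) = modeOp E 0 (casimirOp p q w) := by
  rw [casimirOp_E hK]
  simp only [add_zero, ite_eq_zero_cast]
  module

theorem casimirOp_F_zero (hK : ∀ w : V, modeK • w = w) (p q : ℤ) (w : V) :
    casimirOp p q (modeOp F 0 w) = modeOp F 0 (casimirOp p q w) := by
  rw [casimirOp_F hK]
  simp only [add_zero, ite_eq_zero_cast]
  module

theorem casimirOp_eq_zero {q : ℤ} {w : V} (h : ∀ X, modeOp X q w = 0) (p : ℤ) :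
    casimirOp p q w = 0 := by
  simp only [casimirOp_apply, h, map_zero, smul_zero, add_zero]

theorem IsSmooth.exists_forall_modeOp (hV : IsSmooth V) (w : V) :
    ∃ J : ℕ, ∀ n : ℤ, J ≤ n → ∀ X, modeOp X n w = 0 := by
  obtain ⟨N, hN⟩ := hV w
  exact ⟨N.toNat, fun n hn X => hN n (by omega) X⟩

theorem IsSmooth.casimirOp_finite (hV : IsSmooth V) (w : V) :
    (Function.support fun j : ℕ => casimirOp (-(j + 1)) (j + 1) w).Finite := by
  obtain ⟨J, hJ⟩ := hV.exists_forall_modeOp w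
  refine (Set.finite_Iio J).subset fun j hj => ?_
  by_contra h
  rw [Set.mem_Iio] at h
  exact hj (casimirOp_eq_zero (hJ _ (by omega)) _)

/-- The operator `Ω(0, 0) + 2 ∑_{j > 0} Ω(-j, j)`. -/
def casimirSum (hV : IsSmooth V) : Module.End ℂ V where
  toFun w := casimirOp 0 0 w + (2 : ℂ) • ∑ᶠ j : ℕ, casimirOp (-(j + 1)) (j + 1) w
  map_add' w w' := by
    simp only [map_add]
    rw [finsum_add_distrib (hV.casimirOp_finite w) (hV.casimirOp_finite w')]
    module
  map_smul' c w := by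
    simp only [map_smul, RingHom.id_apply]
    rw [← smul_finsum]
    module

/-- Any sufficiently large cutoff gives the same sum, so the infinite sums at two different vectors
can be compared termwise with one cutoff. -/
theorem casimirSum_eq (hV : IsSmooth V) (w : V) (J : ℕ)
    (hJ : ∀ n : ℤ, J + 1 ≤ n → ∀ X, modeOp X n w = 0) :
    casimirSum hV w = casimirOp 0 0 w
      + (2 : ℂ) • ∑ j ∈ Finset.range J, casimirOp (-((j : ℤ) + 1)) (j + 1) w := by
  change _ + (2 : ℂ) • (∑ᶠ j : ℕ, casimirOp (-((j : ℤ) + 1)) ((j : ℤ) + 1) w) = _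
  congr 2
  refine finsum_eq_sum_of_support_subset _ fun j hj => ?_
  by_contra h
  rw [Finset.mem_coe, Finset.mem_range] at h
  exact hj (casimirOp_eq_zero (hJ _ (by omega)) _)

theorem casimirSum_E_zero (hK : ∀ w : V, modeK • w = w) (hV : IsSmooth V) (w : V) :
    casimirSum hV (modeOp E 0 w) = modeOp E 0 (casimirSum hV w) := by
  obtain ⟨J, hJ⟩ := hV.exists_forall_modeOp w
  obtain ⟨J', hJ'⟩ := hV.exists_forall_modeOp (modeOp E 0 w)
  rw [casimirSum_eq hV w (J + J') fun n hn => hJ n (by push_cast at hn; omega),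
    casimirSum_eq hV (modeOp E 0 w) (J + J') fun n hn => hJ' n (by push_cast at hn; omega)]
  simp only [casimirOp_E_zero hK, map_add, map_smul, map_sum]

theorem casimirSum_F_zero (hK : ∀ w : V, modeK • w = w) (hV : IsSmooth V) (w : V) :
    casimirSum hV (modeOp F 0 w) = modeOp F 0 (casimirSum hV w) := by
  obtain ⟨J, hJ⟩ := hV.exists_forall_modeOp w
  obtain ⟨J', hJ'⟩ := hV.exists_forall_modeOp (modeOp F 0 w)
  rw [casimirSum_eq hV w (J + J') fun n hn => hJ n (by push_cast at hn; omega),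
    casimirSum_eq hV (modeOp F 0 w) (J + J') fun n hn => hJ' n (by push_cast at hn; omega)]
  simp only [casimirOp_F_zero hK, map_add, map_smul, map_sum]

/-- The commutators of the terms `Ω(-j, j)` telescope. The constant `6 = 2 (k + h^∨)` arises as `4`
from reordering in `Ω(0, 0)` plus `2` from the central term of `Ω(-1, 1)`. -/
theorem casimirSum_E_neg_one (hK : ∀ w : V, modeK • w = w) (hV : IsSmooth V) (w : V) :
    casimirSum hV (modeOp E (-1) w) = modeOp E (-1) (casimirSum hV w)
      + (6 : ℂ) • modeOp E (-1) w := by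
  obtain ⟨J, hJ⟩ := hV.exists_forall_modeOp w
  obtain ⟨J', hJ'⟩ := hV.exists_forall_modeOp (modeOp E (-1) w)
  -- The extra `1` keeps the range nonempty, so that the central contribution at `j = 0` is counted.
  rw [casimirSum_eq hV w (J + J' + 1) fun n hn => hJ n (by push_cast at hn; omega),
    casimirSum_eq hV (modeOp E (-1) w) (J + J' + 1) fun n hn => hJ' n (by push_cast at hn; omega)]
  let B : ℕ → V := fun j => modeOp H (-((j : ℤ) + 1)) (modeOp E j w)
    - modeOp E (-((j : ℤ) + 1)) (modeOp H j w)
  have hterm (j : ℕ) : casimirOp (-((j : ℤ) + 1)) (j + 1) (modeOp E (-1) w)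
      = modeOp E (-1) (casimirOp (-((j : ℤ) + 1)) (j + 1) w) + (B j - B (j + 1))
        + if j = 0 then modeOp E (-1) w else 0 := by
    have h2 : -((j : ℤ) + 1) + -1 = -(((j + 1 : ℕ) : ℤ) + 1) := by push_cast; ring
    have h3 : (j : ℤ) + 1 + -1 = j := by ring
    rw [casimirOp_E hK, if_neg (by omega : ¬ -((j : ℤ) + 1) + -1 = 0), zero_smul, add_zero, h2, h3]
    rcases eq_or_ne j 0 with rfl | hj
    · simp [B]
      abel
    · rw [if_neg (by exact_mod_cast hj), if_neg hj, zero_smul]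
      simp only [B, Nat.cast_add, Nat.cast_one]
      abel
  -- The upper end of the telescope lies beyond the cutoff; the lower end `B 0` cancels against
  -- `Ω(0, 0)`.
  have hB : B (J + J' + 1) = 0 := by
    change modeOp H _ (modeOp E _ w) - modeOp E _ (modeOp H _ w) = 0
    rw [hJ _ (by omega), hJ _ (by omega), map_zero, map_zero, sub_zero]
  have hB0 : B 0 = modeOp H (-1) (modeOp E 0 w) - modeOp E (-1) (modeOp H 0 w) := rfl
  have h0 : casimirOp 0 0 (modeOp E (-1) w) = modeOp E (-1) (casimirOp 0 0 w)
      + (4 : ℂ) • modeOp E (-1) w - (2 : ℂ) • B 0 := by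
    have h1 := modeOp_H_E hK 0 (-1) w
    have h2 := modeOp_E_H hK 0 (-1) w
    rw [casimirOp_E hK, hB0]
    norm_num
    rw [zero_add] at h1 h2
    rw [h1, h2]
    module
  simp only [hterm, Finset.sum_add_distrib, Finset.sum_range_sub', hB, h0, map_add, map_smul,
    map_sum]
  simp
  module

end LevelOne

/-! ### Grading by eigenvalues, and vanishing of singular vectors. -/

section LevelOneGrading

variable {V : Type*} [AddCommGroup V] [Module ℂ V] [Module U V] [IsScalarTower ℂ U V]

/-- `X(m)` shifts the eigenvalues of `D` by `-6 m`. -/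
def Shifts (D : Module.End ℂ V) (X : sl2) (m : ℤ) : Prop :=
  ∀ w, D (modeOp X m w) = modeOp X m (D w) - (6 * (m : ℂ)) • modeOp X m w

theorem Shifts.smul {D : Module.End ℂ V} {X : sl2} {m : ℤ} (h : Shifts D X m) (c : ℂ) :
    Shifts D (c • X) m := fun w => by
  rw [modeOp_smul, modeOp_smul, map_smul, h w]
  module

theorem Shifts.lie (hK : ∀ w : V, modeK • w = w) {D : Module.End ℂ V} {X Y : sl2} {m n p : ℤ}
    (hX : Shifts D X m) (hY : Shifts D Y n) (hp : m + n = p) : Shifts D ⁅X, Y⁆ p := fun w => by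
  subst hp
  have h (x : V) : modeOp ⁅X, Y⁆ (m + n) x = modeOp X m (modeOp Y n x) - modeOp Y n (modeOp X m x)
      - (if m + n = 0 then (m : ℂ) * form X Y else 0) • x := by
    rw [modeOp_comm hK]; abel
  rw [h, h]
  simp only [map_sub, map_smul, hX _, hY _]
  -- The central term is a scalar, which commutes with `D`; it occurs only for `m + n = 0`, where
  -- the prescribed shift is zero.
  split_ifs with h0
  · obtain rfl : n = -m := by omega
    push_cast
    module
  · push_cast
    module

theorem Shifts.all {D : Module.End ℂ V} {m : ℤ} (hE : Shifts D E m) (hF : Shifts D F m)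
    (hH : Shifts D H m) (X : sl2) : Shifts D X m := fun w => by
  rw [modeOp_eq, modeOp_eq X m (D w)]
  simp only [map_add, map_smul, hE _, hF _, hH _]
  module

theorem E_eq_smul_lie : E = (1 / 2 : ℂ) • ⁅H, E⁆ := by rw [lie_H_E, smul_smul]; norm_num

theorem F_eq_smul_lie : F = (-1 / 2 : ℂ) • ⁅H, F⁆ := by rw [lie_H_F, smul_smul]; norm_num

theorem shifts_zero (hK : ∀ w : V, modeK • w = w) (hV : IsSmooth V) (X : sl2) :
    Shifts (casimirSum hV) X 0 := by
  have hE : Shifts (casimirSum hV) E 0 := fun w => by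
    rw [casimirSum_E_zero hK, Int.cast_zero, mul_zero, zero_smul, sub_zero]
  have hF : Shifts (casimirSum hV) F 0 := fun w => by
    rw [casimirSum_F_zero hK, Int.cast_zero, mul_zero, zero_smul, sub_zero]
  have hH : Shifts (casimirSum hV) H 0 := lie_E_F ▸ hE.lie hK hF (add_zero 0)
  exact .all hE hF hH X

/-- Shifting passes to brackets, and up to central terms the zero modes together with `E(-1)`
generate all nonpositive modes. Hence the single computation `casimirSum_E_neg_one` suffices in
negative degree. -/
theorem shifts_neg (hK : ∀ w : V, modeK • w = w) (hV : IsSmooth V) (n : ℕ) :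
    ∀ X : sl2, Shifts (casimirSum hV) X (-n) := by
  have h0 := shifts_zero hK hV
  have h1 : ∀ X, Shifts (casimirSum hV) X (-1) := by
    have hE : Shifts (casimirSum hV) E (-1) := fun w => by
      rw [casimirSum_E_neg_one hK]
      push_cast
      module
    have hH : Shifts (casimirSum hV) H (-1) := lie_E_F ▸ hE.lie hK (h0 F) (add_zero _)
    have hF : Shifts (casimirSum hV) F (-1) :=
      F_eq_smul_lie ▸ (hH.lie hK (h0 F) (add_zero _)).smul _
    exact .all hE hF hH
  induction n with
  | zero => simpa using h0
  | succ n ih =>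
    have hn : -1 + -(n : ℤ) = -((n + 1 : ℕ) : ℤ) := by push_cast; ring
    exact .all (E_eq_smul_lie ▸ ((h1 H).lie hK (ih E) hn).smul _)
      (F_eq_smul_lie ▸ ((h1 H).lie hK (ih F) hn).smul _) (lie_E_F ▸ (h1 E).lie hK (ih F) hn)

theorem shifts_of_nonpos (hK : ∀ w : V, modeK • w = w) (hV : IsSmooth V) (X : sl2) {m : ℤ}
    (hm : m ≤ 0) : Shifts (casimirSum hV) X m := by
  obtain ⟨n, rfl⟩ : ∃ n : ℕ, m = -n := ⟨m.natAbs, by omega⟩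
  exact shifts_neg hK hV n X

/-- The span of the vectors obtained from `s` by applying nonpositive modes. -/
inductive Descends (s : V) : V → Prop
  | base : Descends s s
  | zero : Descends s 0
  | add {x y : V} : Descends s x → Descends s y → Descends s (x + y)
  | smul (c : ℂ) {x : V} : Descends s x → Descends s (c • x)
  | mode (X : sl2) {m : ℤ} (hm : m ≤ 0) {x : V} : Descends s x → Descends s (modeOp X m x)

/-- A positive mode can be commuted to the right until it reaches `s` and kills it, so the
descendants form a submodule. -/
theorem Descends.mode_all (hK : ∀ w : V, modeK • w = w) {s : V}
    (hs : ∀ X, ∀ n : ℤ, 0 < n → modeOp X n s = 0) {w : V} (hw : Descends s w) :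
    ∀ X n, Descends s (modeOp X n w) := by
  induction hw with
  | base =>
    intro X n
    rcases le_or_gt n 0 with hn | hn
    · exact .mode X hn .base
    · rw [hs X n hn]; exact .zero
  | zero => intro X n; rw [map_zero]; exact .zero
  | add _ _ hx hy => intro X n; rw [map_add]; exact .add (hx X n) (hy X n)
  | smul c _ hx => intro X n; rw [map_smul]; exact .smul c (hx X n)
  | mode Y hm hx ih =>
    intro X n
    rw [modeOp_comm hK]
    exact .add (.add (.mode Y hm (ih X n)) (ih _ _)) (.smul _ hx)

/-- A vector that is annihilated by the positive modes generates its descendants. -/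
theorem descends_of_isSimpleModule [IsSimpleModule U V] (hK : ∀ w : V, modeK • w = w) {s : V}
    (hs : ∀ X, ∀ n : ℤ, 0 < n → modeOp X n s = 0) (hs0 : s ≠ 0) (w : V) : Descends s w := by
  let W : Submodule ℂ V :=
    { carrier := {w | Descends s w}
      zero_mem' := .zero
      add_mem' := .add
      smul_mem' := fun c _ => .smul c }
  let P : Submodule U V :=
    { W with
      smul_mem' := fun u w hw => smul_mem_of_mode W (fun X n w hw => hw.mode_all hK hs X n)
        (fun w hw => by rwa [hK]) u w hw }
  have hP : P = ⊤ := by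
    refine (eq_bot_or_eq_top P).resolve_left fun h => hs0 ?_
    have : s ∈ P := .base
    rwa [h, Submodule.mem_bot] at this
  have : w ∈ P := hP ▸ Submodule.mem_top
  exact this

theorem Descends.mem_iSup_eigenspace (hK : ∀ w : V, modeK • w = w) (hV : IsSmooth V) {s : V}
    {a : ℂ} (hs : casimirSum hV s = a • s) {w : V} (hw : Descends s w) :
    w ∈ ⨆ n : ℕ, (casimirSum hV).eigenspace (a + 6 * n) := by
  induction hw with
  | base =>
    refine Submodule.mem_iSup_of_mem 0 ?_
    rwa [Nat.cast_zero, mul_zero, add_zero, Module.End.mem_eigenspace_iff]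
  | zero => exact zero_mem _
  | add _ _ hx hy => exact add_mem hx hy
  | smul c _ hx => exact Submodule.smul_mem _ c hx
  | @mode X m hm x hxd hx =>
    clear hxd
    obtain ⟨k, rfl⟩ : ∃ k : ℕ, m = -k := ⟨m.natAbs, by omega⟩
    induction hx using Submodule.iSup_induction' with
    | mem n y hy =>
      refine Submodule.mem_iSup_of_mem (n + k) ?_
      rw [Module.End.mem_eigenspace_iff] at hy ⊢
      rw [shifts_neg hK hV k X y, hy, map_smul]
      push_cast
      module
    | zero => rw [map_zero]; exact zero_mem _
    | add y z _ _ hy hz => rw [map_add]; exact add_mem hy hz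

/-- In an irreducible representation, a vector annihilated by the positive modes vanishes if its
degree exceeds that of a nonzero vector. -/
theorem eq_zero_of_singular [IsSimpleModule U V] (hK : ∀ w : V, modeK • w = w) (hV : IsSmooth V)
    {s v : V} {a : ℂ} (hv0 : v ≠ 0) (hv : casimirSum hV v = a • v)
    (hs : ∀ X, ∀ n : ℤ, 0 < n → modeOp X n s = 0) (hs' : casimirSum hV s = (a + 6) • s) :
    s = 0 := by
  by_contra hs0
  have hmem := (descends_of_isSimpleModule hK hs hs0 v).mem_iSup_eigenspace hK hV hs'
  have hind := (casimirSum hV).eigenspaces_iSupIndep a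
  refine hv0 (Submodule.disjoint_def.1 hind v (Module.End.mem_eigenspace_iff.2 hv) ?_)
  have hle : ⨆ n : ℕ, (casimirSum hV).eigenspace (a + 6 + 6 * n)
      ≤ ⨆ b, ⨆ _ : b ≠ a, (casimirSum hV).eigenspace b :=
    -- The eigenvalue `a` does not recur, since `a + 6 + 6n = a` would mean `n + 1 = 0`.
    iSup_le fun n => le_iSup₂_of_le (a + 6 + 6 * n) (fun h => by
      have h' : ((n + 1 : ℕ) : ℂ) = 0 := by push_cast; linear_combination h / 6
      rw [Nat.cast_eq_zero] at h'
      omega) le_rfl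
  exact hle hmem

end LevelOneGrading

/-! ### Sugawara operators on vectors of degree zero and one. -/

section LevelOneTop

variable {V : Type*} [AddCommGroup V] [Module ℂ V] [Module U V] [IsScalarTower ℂ U V]

theorem normalOrdered_smul (Y : sl2) (p q : ℤ) (w : V) : normalOrdered Y Y p q • w
    = if p < q then modeOp Y p (modeOp Y q w) else modeOp Y q (modeOp Y p w) := by
  rw [normalOrdered]
  split_ifs <;> rw [mul_smul] <;> rfl

/-- Normal ordering pairs `j` with `-1 - j`, whence the factor `2`. Modes of index `1` are allowed
to survive because the formula is also needed at `H(-1) v` and `H(-1) v'`. -/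
theorem normalOrderedSum_neg_one (hV : IsSmooth V) (Y : sl2) {w : V}
    (hw : ∀ n : ℤ, 2 ≤ n → modeOp Y n w = 0) : normalOrderedSum hV Y Y (-1) w
      = (2 : ℂ) • (modeOp Y (-1) (modeOp Y 0 w) + modeOp Y (-2) (modeOp Y 1 w)) := by
  change ∑ᶠ j : ℤ, normalOrdered Y Y (-1 - j) j • w = _
  rw [finsum_eq_sum_of_support_subset (s := {-2, -1, 0, 1})]
  · simp [normalOrdered_smul]
    module
  · intro j hj
    by_contra hmem
    simp only [Finset.coe_insert, Finset.coe_singleton, Set.mem_insert_iff,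
      Set.mem_singleton_iff] at hmem
    refine hj ?_
    dsimp only
    rw [normalOrdered_smul]
    split_ifs
    · rw [hw j (by omega), map_zero]
    · rw [hw (-1 - j) (by omega), map_zero]

theorem normalOrderedSum_neg_two (hV : IsSmooth V) (Y : sl2) {w : V}
    (hw : ∀ n : ℤ, 1 ≤ n → modeOp Y n w = 0) : normalOrderedSum hV Y Y (-2) w
      = (2 : ℂ) • modeOp Y (-2) (modeOp Y 0 w) + modeOp Y (-1) (modeOp Y (-1) w) := by
  change ∑ᶠ j : ℤ, normalOrdered Y Y (-2 - j) j • w = _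
  rw [finsum_eq_sum_of_support_subset (s := {-2, -1, 0})]
  · simp [normalOrdered_smul]
    module
  · intro j hj
    by_contra hmem
    simp only [Finset.coe_insert, Finset.coe_singleton, Set.mem_insert_iff,
      Set.mem_singleton_iff] at hmem
    refine hj ?_
    dsimp only
    rw [normalOrdered_smul]
    split_ifs
    · rw [hw j (by omega), map_zero]
    · rw [hw (-2 - j) (by omega), map_zero]

theorem sum_modeOp_modeOp (X : Module.Basis (Fin 3) ℂ sl2)
    (hX : ∀ r s, form (X r) (X s) = if r = s then 1 else 0) (p q : ℤ) (w : V) :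
    ∑ r, modeOp (X r) p (modeOp (X r) q w) = casimirOp p q w :=
  sum_orthonormal X hX (LinearMap.mk₂ ℂ (fun Y Z => modeOp Y p (modeOp Z q w))
    (fun _ _ _ => modeOp_add _ _ _ _) (fun _ _ _ => modeOp_smul _ _ _ _)
    (fun _ _ _ => by rw [modeOp_add, map_add]) (fun _ _ _ => by rw [modeOp_smul, map_smul]))

theorem sugawara_neg_one (hV : IsSmooth V) (X : Module.Basis (Fin 3) ℂ sl2)
    (hX : ∀ r s, form (X r) (X s) = if r = s then 1 else 0) {w : V}
    (hw : ∀ Y, ∀ n : ℤ, 2 ≤ n → modeOp Y n w = 0) : sugawara hV 1 X (-1) w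
      = (1 / 3 : ℂ) • (casimirOp (-1) 0 w + casimirOp (-2) 1 w) := by
  rw [sugawara, LinearMap.smul_apply, LinearMap.sum_apply]
  simp only [normalOrderedSum_neg_one hV _ (hw _)]
  rw [← Finset.smul_sum, Finset.sum_add_distrib, sum_modeOp_modeOp X hX, sum_modeOp_modeOp X hX,
    smul_smul, dualCoxeter]
  norm_num

theorem sugawara_neg_two (hV : IsSmooth V) (X : Module.Basis (Fin 3) ℂ sl2)
    (hX : ∀ r s, form (X r) (X s) = if r = s then 1 else 0) {w : V}
    (hw : ∀ Y, ∀ n : ℤ, 1 ≤ n → modeOp Y n w = 0) : sugawara hV 1 X (-2) w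
      = (1 / 6 : ℂ) • ((2 : ℂ) • casimirOp (-2) 0 w + casimirOp (-1) (-1) w) := by
  rw [sugawara, LinearMap.smul_apply, LinearMap.sum_apply]
  simp only [normalOrderedSum_neg_two hV _ (hw _)]
  rw [Finset.sum_add_distrib, ← Finset.smul_sum, sum_modeOp_modeOp X hX, sum_modeOp_modeOp X hX,
    dualCoxeter]
  norm_num

/-- The vectors `v` and `v'` span a fundamental representation of `sl₂` that is annihilated by the
positive modes. -/
structure IsFundamentalTop (v v' : V) : Prop where
  E_v : modeOp E 0 v = 0
  H_v : modeOp H 0 v = v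
  F_v : modeOp F 0 v = v'
  E_v' : modeOp E 0 v' = v
  H_v' : modeOp H 0 v' = -v'
  F_v' : modeOp F 0 v' = 0
  pos_v : ∀ X, ∀ n : ℤ, 1 ≤ n → modeOp X n v = 0
  pos_v' : ∀ X, ∀ n : ℤ, 1 ≤ n → modeOp X n v' = 0

/-! ### The singular vector and its consequences in degrees one and two. -/

namespace IsFundamentalTop

variable {v v' : V}

/-- Commuting leaves only a mode of index `n - 1 ≥ 1` and no central term; singularity thus needs
checking only at `n = 1`. -/
theorem pos_mode_neg_one {w : V} (hK : ∀ w : V, modeK • w = w)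
    (hw : ∀ X, ∀ n : ℤ, 1 ≤ n → modeOp X n w = 0) (Z Y : sl2) (n : ℤ) (hn : 2 ≤ n) :
    modeOp Y n (modeOp Z (-1) w) = 0 := by
  rw [modeOp_comm hK, hw Y n (by omega), hw _ _ (by omega), if_neg (by omega), map_zero,
    zero_smul, add_zero, add_zero]

theorem E_neg_one_v [IsSimpleModule U V] (h : IsFundamentalTop v v')
    (hK : ∀ w : V, modeK • w = w) (hV : IsSmooth V) (hv0 : v ≠ 0) : modeOp E (-1) v = 0 := by
  have hv : casimirSum hV v = (3 / 2 : ℂ) • v := by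
    rw [casimirSum_eq hV v 0 fun n hn X => h.pos_v X n (by simpa using hn), casimirOp_apply, h.F_v,
      h.E_v, h.H_v, h.H_v, h.E_v', map_zero, Finset.range_zero, Finset.sum_empty]
    module
  refine eq_zero_of_singular hK hV hv0 hv (fun X n hn => ?_) ?_
  · rcases eq_or_lt_of_le (show 1 ≤ n from hn) with rfl | hn
    · refine modeOp_eq_zero ?_ ?_ ?_ X
      · rw [modeOp_E_E hK, h.pos_v _ _ le_rfl, map_zero]
      -- The central term `v` cancels `-H(0) v = -v`: level and highest weight are both `1`.
      · rw [modeOp_F_E hK, h.pos_v _ _ le_rfl, map_zero]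
        norm_num [h.H_v]
      · rw [modeOp_H_E hK, h.pos_v _ _ le_rfl, map_zero]
        norm_num [h.E_v]
    · exact pos_mode_neg_one hK h.pos_v E X n hn
  · rw [shifts_of_nonpos hK hV E (by norm_num) v, hv, map_smul]
    push_cast
    module

/-- Obtained by applying `F(0)` to `E(-1) v = 0`. Two further applications of `F(0)` give
`F_neg_one_v` and `F_neg_one_v'`. -/
theorem E_neg_one_v' (h : IsFundamentalTop v v') (hK : ∀ w : V, modeK • w = w)
    (h1 : modeOp E (-1) v = 0) : modeOp E (-1) v' = modeOp H (-1) v := by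
  have h2 := modeOp_F_E hK 0 (-1) v
  rw [h1, map_zero, h.F_v] at h2
  norm_num at h2
  linear_combination (norm := module) (-1 : ℂ) • h2

theorem F_neg_one_v (h : IsFundamentalTop v v') (hK : ∀ w : V, modeK • w = w)
    (h1 : modeOp E (-1) v = 0) : modeOp F (-1) v = -modeOp H (-1) v' := by
  have h2 := modeOp_F_E hK 0 (-1) v'
  rw [h.E_neg_one_v' hK h1, h.F_v', modeOp_F_H hK, h.F_v] at h2
  norm_num at h2
  linear_combination (norm := module) (1 / 2 : ℂ) • h2

theorem F_neg_one_v' (h : IsFundamentalTop v v') (hK : ∀ w : V, modeK • w = w)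
    (h1 : modeOp E (-1) v = 0) : modeOp F (-1) v' = 0 := by
  have h2 := congrArg (modeOp F 0) (h.F_neg_one_v hK h1)
  rw [map_neg, modeOp_F_F hK, modeOp_F_H hK, h.F_v, h.F_v'] at h2
  norm_num at h2
  linear_combination (norm := module) (1 / 3 : ℂ) • h2

/-- Compare the two orders of `E(-1)` and `F(-1)` on `v`: one vanishes, and the commutator is
`H(-2)` without central term. -/
theorem E_neg_one_H_neg_one_v' (h : IsFundamentalTop v v') (hK : ∀ w : V, modeK • w = w)
    (h1 : modeOp E (-1) v = 0) : modeOp E (-1) (modeOp H (-1) v') = -modeOp H (-2) v := by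
  have h2 := modeOp_E_F hK (-1) (-1) v
  rw [h1, map_zero, h.F_neg_one_v hK h1, map_neg] at h2
  norm_num at h2
  linear_combination (norm := module) (-1 : ℂ) • h2

theorem F_neg_one_H_neg_one_v (h : IsFundamentalTop v v') (hK : ∀ w : V, modeK • w = w)
    (h1 : modeOp E (-1) v = 0) : modeOp F (-1) (modeOp H (-1) v) = -modeOp H (-2) v' := by
  have h2 := modeOp_F_E hK (-1) (-1) v'
  rw [h.F_neg_one_v' hK h1, map_zero, h.E_neg_one_v' hK h1] at h2
  norm_num at h2
  exact h2

/-- Since `[H(-1), E(-1)] = 2 E(-2)`, applying `H(-1)` to the relation for `E(-1) v'` determines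
`E(-2) v'`. -/
theorem E_neg_two_v' (h : IsFundamentalTop v v') (hK : ∀ w : V, modeK • w = w)
    (h1 : modeOp E (-1) v = 0) : modeOp E (-2) v'
      = (1 / 2 : ℂ) • (modeOp H (-1) (modeOp H (-1) v) + modeOp H (-2) v) := by
  have h2 := modeOp_H_E hK (-1) (-1) v'
  rw [h.E_neg_one_v' hK h1, h.E_neg_one_H_neg_one_v' hK h1] at h2
  norm_num at h2
  linear_combination (norm := module) (-1 / 2 : ℂ) • h2

theorem F_neg_two_v (h : IsFundamentalTop v v') (hK : ∀ w : V, modeK • w = w)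
    (h1 : modeOp E (-1) v = 0) : modeOp F (-2) v
      = (1 / 2 : ℂ) • (modeOp H (-1) (modeOp H (-1) v') - modeOp H (-2) v') := by
  have h2 := modeOp_H_F hK (-1) (-1) v
  rw [h.F_neg_one_v hK h1, h.F_neg_one_H_neg_one_v hK h1, map_neg] at h2
  norm_num at h2
  linear_combination (norm := module) (1 / 2 : ℂ) • h2

theorem casimirOp_neg_one_v (h : IsFundamentalTop v v') (hK : ∀ w : V, modeK • w = w)
    (h1 : modeOp E (-1) v = 0) : casimirOp (-1) (-1) v
      = (1 / 2 : ℂ) • modeOp H (-1) (modeOp H (-1) v) + modeOp H (-2) v := by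
  rw [casimirOp_apply, h1, map_zero, h.F_neg_one_v hK h1, map_neg, h.E_neg_one_H_neg_one_v' hK h1]
  module

theorem casimirOp_neg_one_v' (h : IsFundamentalTop v v') (hK : ∀ w : V, modeK • w = w)
    (h1 : modeOp E (-1) v = 0) : casimirOp (-1) (-1) v'
      = (1 / 2 : ℂ) • modeOp H (-1) (modeOp H (-1) v') - modeOp H (-2) v' := by
  rw [casimirOp_apply, h.F_neg_one_v' hK h1, map_zero, h.E_neg_one_v' hK h1,
    h.F_neg_one_H_neg_one_v hK h1]
  module

variable (X : Module.Basis (Fin 3) ℂ sl2)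

theorem sugawara_neg_two_v (h : IsFundamentalTop v v') (hK : ∀ w : V, modeK • w = w)
    (h1 : modeOp E (-1) v = 0) (hV : IsSmooth V)
    (hX : ∀ r s, form (X r) (X s) = if r = s then 1 else 0) : sugawara hV 1 X (-2) v
      = (1 / 2 : ℂ) • ((1 / 2 : ℂ) • modeOp H (-1) (modeOp H (-1) v) + modeOp H (-2) v) := by
  rw [sugawara_neg_two hV X hX h.pos_v, h.casimirOp_neg_one_v hK h1, casimirOp_apply, h.F_v, h.E_v,
    h.H_v, h.E_neg_two_v' hK h1, map_zero]
  module

theorem sugawara_neg_two_v' (h : IsFundamentalTop v v') (hK : ∀ w : V, modeK • w = w)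
    (h1 : modeOp E (-1) v = 0) (hV : IsSmooth V)
    (hX : ∀ r s, form (X r) (X s) = if r = s then 1 else 0) : sugawara hV 1 X (-2) v'
      = (1 / 2 : ℂ) • ((1 / 2 : ℂ) • modeOp H (-1) (modeOp H (-1) v') - modeOp H (-2) v') := by
  rw [sugawara_neg_two hV X hX h.pos_v', h.casimirOp_neg_one_v' hK h1, casimirOp_apply, h.F_v',
    h.E_v', h.H_v', h.F_neg_two_v hK h1, map_zero, map_neg]
  module

theorem sugawara_neg_one_v (h : IsFundamentalTop v v') (hK : ∀ w : V, modeK • w = w)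
    (h1 : modeOp E (-1) v = 0) (hV : IsSmooth V)
    (hX : ∀ r s, form (X r) (X s) = if r = s then 1 else 0) : sugawara hV 1 X (-1) v
      = (1 / 2 : ℂ) • modeOp H (-1) v := by
  rw [sugawara_neg_one hV X hX fun Y n hn => h.pos_v Y n (by omega),
    casimirOp_eq_zero (fun Y => h.pos_v Y 1 le_rfl), casimirOp_apply, h.F_v, h.E_v, h.H_v,
    h.E_neg_one_v' hK h1, map_zero]
  module

theorem sugawara_neg_one_v' (h : IsFundamentalTop v v') (hK : ∀ w : V, modeK • w = w)
    (h1 : modeOp E (-1) v = 0) (hV : IsSmooth V)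
    (hX : ∀ r s, form (X r) (X s) = if r = s then 1 else 0) : sugawara hV 1 X (-1) v'
      = (-1 / 2 : ℂ) • modeOp H (-1) v' := by
  rw [sugawara_neg_one hV X hX fun Y n hn => h.pos_v' Y n (by omega),
    casimirOp_eq_zero (fun Y => h.pos_v' Y 1 le_rfl), casimirOp_apply, h.F_v', h.E_v', h.H_v',
    h.F_neg_one_v hK h1, map_zero, map_neg]
  module

/-- This gives `L_{-1}² v`, because `L_{-1} v` is half of `H(-1) v`. -/
theorem sugawara_neg_one_H_v (h : IsFundamentalTop v v') (hK : ∀ w : V, modeK • w = w)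
    (h1 : modeOp E (-1) v = 0) (hV : IsSmooth V)
    (hX : ∀ r s, form (X r) (X s) = if r = s then 1 else 0) :
    sugawara hV 1 X (-1) (modeOp H (-1) v)
      = (1 / 2 : ℂ) • modeOp H (-1) (modeOp H (-1) v) + modeOp H (-2) v := by
  have hE0 : modeOp E 0 (modeOp H (-1) v) = 0 := by
    rw [modeOp_E_H hK, h.E_v]; simp [h1]
  have hF0 : modeOp F 0 (modeOp H (-1) v) = -modeOp H (-1) v' := by
    rw [modeOp_F_H hK, h.F_v, zero_add, h.F_neg_one_v hK h1]; module
  have hH0 : modeOp H 0 (modeOp H (-1) v) = modeOp H (-1) v := by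
    rw [modeOp_H_H hK, h.H_v]; simp
  have hE1 : modeOp E 1 (modeOp H (-1) v) = 0 := by
    rw [modeOp_E_H hK, h.pos_v _ _ le_rfl]; simp [h.E_v]
  have hF1 : modeOp F 1 (modeOp H (-1) v) = (2 : ℂ) • v' := by
    rw [modeOp_F_H hK, h.pos_v _ _ le_rfl]; simp [h.F_v]
  have hH1 : modeOp H 1 (modeOp H (-1) v) = (2 : ℂ) • v := by
    rw [modeOp_H_H hK, h.pos_v _ _ le_rfl]; simp
  rw [sugawara_neg_one hV X hX (pos_mode_neg_one hK h.pos_v H), casimirOp_apply, casimirOp_apply,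
    hE0, hF0, hH0, hE1, hF1, hH1, map_neg, h.E_neg_one_H_neg_one_v' hK h1, map_smul, map_smul,
    h.E_neg_two_v' hK h1, map_zero, map_zero]
  module

theorem sugawara_neg_one_H_v' (h : IsFundamentalTop v v') (hK : ∀ w : V, modeK • w = w)
    (h1 : modeOp E (-1) v = 0) (hV : IsSmooth V)
    (hX : ∀ r s, form (X r) (X s) = if r = s then 1 else 0) :
    sugawara hV 1 X (-1) (modeOp H (-1) v')
      = (-1 / 2 : ℂ) • modeOp H (-1) (modeOp H (-1) v') + modeOp H (-2) v' := by
  have hE0 : modeOp E 0 (modeOp H (-1) v') = -modeOp H (-1) v := by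
    rw [modeOp_E_H hK, h.E_v', zero_add, h.E_neg_one_v' hK h1]; module
  have hF0 : modeOp F 0 (modeOp H (-1) v') = 0 := by
    rw [modeOp_F_H hK, h.F_v']; simp [h.F_neg_one_v' hK h1]
  have hH0 : modeOp H 0 (modeOp H (-1) v') = -modeOp H (-1) v' := by
    rw [modeOp_H_H hK, h.H_v']; simp
  have hE1 : modeOp E 1 (modeOp H (-1) v') = (-2 : ℂ) • v := by
    rw [modeOp_E_H hK, h.pos_v' _ _ le_rfl]; simp [h.E_v']
  have hF1 : modeOp F 1 (modeOp H (-1) v') = 0 := by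
    rw [modeOp_F_H hK, h.pos_v' _ _ le_rfl]; simp [h.F_v']
  have hH1 : modeOp H 1 (modeOp H (-1) v') = (2 : ℂ) • v' := by
    rw [modeOp_H_H hK, h.pos_v' _ _ le_rfl]; simp
  rw [sugawara_neg_one hV X hX (pos_mode_neg_one hK h.pos_v' H), casimirOp_apply, casimirOp_apply,
    hE0, hF0, hH0, hE1, hF1, hH1, map_neg, map_neg, h.F_neg_one_H_neg_one_v hK h1, map_smul,
    map_smul, h.F_neg_two_v hK h1, map_zero, map_zero]
  module

end IsFundamentalTop

end LevelOneTop

/-! ### The fundamental top space and the final identity. -/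

theorem isFundamentalTop_top {M : Type*} [AddCommGroup M] [Module ℂ M] [LieRingModule sl2 M]
    [LieModule ℂ sl2 M] [FiniteDimensional ℂ M] {k : ℂ} (N : Submodule U (Induced M k)) {v : M}
    (hE : ⁅E, v⁆ = 0) (hH : ⁅H, v⁆ = v) : IsFundamentalTop (top N v) (top N ⁅F, v⁆) where
  E_v := by rw [modeOp_apply, mode_zero_smul_top, hE]; exact map_zero (topₗ N)
  H_v := by rw [modeOp_apply, mode_zero_smul_top, hH]
  F_v := by rw [modeOp_apply, mode_zero_smul_top]
  E_v' := by
    rw [modeOp_apply, mode_zero_smul_top, leibniz_lie, lie_E_F, hE, hH, lie_zero, add_zero]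
  H_v' := by
    rw [modeOp_apply, mode_zero_smul_top, leibniz_lie, lie_H_F, hH, smul_lie, neg_smul, two_smul,
      neg_add, neg_add_cancel_right]
    exact map_neg (topₗ N) _
  F_v' := by
    rw [modeOp_apply, mode_zero_smul_top, lie_F_lie_F hE hH]
    exact map_zero (topₗ N)
  pos_v _ _ hn := mode_pos_smul_top N _ _ (by omega)
  pos_v' _ _ hn := mode_pos_smul_top N _ _ (by omega)

end

end AffineSl2

theorem mainTheorem7
    -- the fundamental representation of `sl₂`, with a highest weight vector `v`
    {M : Type*} [AddCommGroup M] [Module ℂ M] [LieRingModule AffineSl2.sl2 M]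
    [LieModule ℂ AffineSl2.sl2 M] [FiniteDimensional ℂ M]
    [LieModule.IsIrreducible ℂ AffineSl2.sl2 M]
    (v : M) (hv : v ≠ 0) (hE : ⁅AffineSl2.E, v⁆ = 0) (hH : ⁅AffineSl2.H, v⁆ = v)
    -- the irreducible quotient of the induced representation of level one
    (N : Submodule AffineSl2.U (AffineSl2.Induced M 1))
    [IsSimpleModule AffineSl2.U (AffineSl2.Induced M 1 ⧸ N)]
    -- an orthonormal basis of `sl₂`
    (X : Module.Basis (Fin 3) ℂ AffineSl2.sl2)
    (hX : ∀ r s, AffineSl2.form (X r) (X s) = if r = s then 1 else 0)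
    (κ τ : ℂ) (hκτ : κ + 2 * τ - 4 = 0) :
    ∀ w ∈ ({v, ⁅AffineSl2.F, v⁆} : Set M),
      ((-2 : ℂ) • AffineSl2.virasoro N X (-2) + (κ / 2) • AffineSl2.virasoro N X (-1) ^ 2 +
        (τ / 2) • ∑ r, AffineSl2.act (AffineSl2.Induced M 1 ⧸ N) (AffineSl2.mode (X r) (-1)) ^ 2)
        (AffineSl2.top N w) = 0 := by
  have hK : ∀ w : AffineSl2.Induced M 1 ⧸ N, AffineSl2.modeK • w = w := fun w => by
    rw [AffineSl2.modeK_smul_quotient, one_smul]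
  have hV := AffineSl2.isSmooth_quotient N
  have h := AffineSl2.isFundamentalTop_top N hE hH
  have : Nontrivial (AffineSl2.Induced M 1 ⧸ N) :=
    IsSimpleModule.nontrivial AffineSl2.U (AffineSl2.Induced M 1 ⧸ N)
  have h1 := h.E_neg_one_v hK hV (AffineSl2.top_ne_zero N hv)
  obtain rfl : κ = 4 - 2 * τ := by linear_combination hκτ
  have hsum (w : AffineSl2.Induced M 1 ⧸ N) :
      (∑ r, AffineSl2.act (AffineSl2.Induced M 1 ⧸ N) (AffineSl2.mode (X r) (-1)) ^ 2) w
        = AffineSl2.casimirOp (-1) (-1) w := by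
    rw [← AffineSl2.sum_modeOp_modeOp X hX, LinearMap.sum_apply]
    rfl
  intro w hw
  rw [LinearMap.add_apply, LinearMap.add_apply, LinearMap.smul_apply, LinearMap.smul_apply,
    LinearMap.smul_apply, hsum, pow_two, Module.End.mul_apply, AffineSl2.virasoro,
    AffineSl2.virasoro]
  -- In each case the three summands are `-1`, `κ/4` and `τ/2` times one vector, `(1/2) H(-1)² +
  -- H(-2)` at `v` and `(1/2) H(-1)² - H(-2)` at `v'`.
  rcases hw with rfl | rfl
  · rw [h.sugawara_neg_two_v X hK h1 hV hX, h.sugawara_neg_one_v X hK h1 hV hX, map_smul,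
      h.sugawara_neg_one_H_v X hK h1 hV hX, h.casimirOp_neg_one_v hK h1]
    module
  · rw [h.sugawara_neg_two_v' X hK h1 hV hX, h.sugawara_neg_one_v' X hK h1 hV hX, map_smul,
      h.sugawara_neg_one_H_v' X hK h1 hV hX, h.casimirOp_neg_one_v' hK h1]
    module
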